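/- Let $G$ be a profinite group (a compact, Hausdorff, totally disconnected topological group). Call $G$ a profinite-$C$ group if every closed subgroup $H$ of $G$ has a closed permutable complement, that is, a closed subgroup $K$ of $G$ with $G=HK$ and $H\cap K=1$. Call $G$ a profinite-$SC$ group if for every closed subgroup $H$ of $G$ there exists a subgroup $K$ of $G$ such that, for every closed subgroup $J$ of $G$ with $H\le J\le G$, the subgroup $J\cap K$ is a (not necessarily permutable) complement of $H$ in $J$, that is, $H\cap(J\cap K)=1$ and $\langle H, J\cap K\rangle=J$. Proposition. $G$ is a profinite-$SC$ group if and only if $G$ is a profinite-$C$ group. -/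

import Mathlib

/-- `G` is a profinite-`C` group (for `G` a profinite group): every closed subgroup `H` of `G`
has a closed permutable complement, i.e. a closed subgroup `K` with `G = HK` and `H ∩ K = 1`. -/
def IsProfiniteC (G : Type*) [Group G] [TopologicalSpace G] : Prop :=
  ∀ H : Subgroup G, IsClosed (H : Set G) →
    ∃ K : Subgroup G, IsClosed (K : Set G) ∧ Subgroup.IsComplement' H K

/-- `L` is a (not necessarily permutable) complement of `H` in `J`, where `H, L ≤ J ≤ G`:
`H` and `L` intersect trivially and together generate `J`. -/
def IsComplementIn {G : Type*} [Group G] (H L J : Subgroup G) : Prop :=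
  H ≤ J ∧ L ≤ J ∧ H ⊓ L = ⊥ ∧ H ⊔ L = J

/-- `G` is a profinite-`SC` group (for `G` a profinite group): for every closed subgroup `H` of `G`
there is a subgroup `K` of `G` such that `J ∩ K` is a complement of `H` in `J` for every closed
subgroup `J` with `H ≤ J ≤ G`. -/
def IsProfiniteSC (G : Type*) [Group G] [TopologicalSpace G] : Prop :=
  ∀ H : Subgroup G, IsClosed (H : Set G) →
    ∃ K : Subgroup G, ∀ J : Subgroup G, IsClosed (J : Set G) → H ≤ J →
      IsComplementIn H (J ⊓ K) J

open scoped Pointwise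

section SC

variable {G : Type*} [Group G] [TopologicalSpace G]

/-! C implies SC by Dedekind's modular law. For the converse, SC passes to closed subgroups and
quotients. A finite SC group is solvable: for the least prime `p` dividing its order, a Sylow
`p`-subgroup is abelian and central in its normalizer, so Burnside's transfer yields a normal
`p`-complement, and induction applies. In a finite solvable SC group every `D ≠ 1` has a proper
supplement, taken from a complement inside the derived series; this lifts to profinite groups. Given
closed `H`, compactness yields a minimal closed `K` with `G = HK`. If `D = H ∩ K ≠ 1`, then `K = DL`
with `L < K` closed, so `G = HL`, contradicting minimality. -/

theorem isProfiniteSC_iff : IsProfiniteSC G ↔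
    ∀ H : Subgroup G, IsClosed (H : Set G) → ∃ K : Subgroup G, H ⊓ K = ⊥ ∧
      ∀ J : Subgroup G, IsClosed (J : Set G) → H ≤ J → H ⊔ (J ⊓ K) = J := by
  constructor
  · intro h H hH
    obtain ⟨K, hK⟩ := h H hH
    refine ⟨K, ?_, fun J hJ hHJ => (hK J hJ hHJ).2.2.2⟩
    have := (hK ⊤ isClosed_univ le_top).2.2.1
    rwa [top_inf_eq] at this
  · intro h H hH
    obtain ⟨K, hK, hJ⟩ := h H hH
    refine ⟨K, fun J hJc hHJ => ⟨hHJ, inf_le_left, ?_, hJ J hJc hHJ⟩⟩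
    rw [inf_left_comm, hK, inf_bot_eq]

theorem IsProfiniteC.isProfiniteSC (h : IsProfiniteC G) : IsProfiniteSC G := by
  rw [isProfiniteSC_iff]
  intro H hH
  obtain ⟨K, -, hK⟩ := h H hH
  refine ⟨K, hK.disjoint.eq_bot, fun J _ hHJ => le_antisymm (sup_le hHJ inf_le_left) ?_⟩
  intro x hx
  obtain ⟨a, ha, b, hb, rfl⟩ : x ∈ (H : Set G) * (K : Set G) := by
    rw [Subgroup.IsComplement.mul_eq hK]; trivial
  refine mul_mem (Subgroup.mem_sup_left ha) (Subgroup.mem_sup_right ⟨?_, hb⟩)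
  exact (Subgroup.mul_mem_cancel_left J (hHJ ha)).1 hx

/-! ### Heredity of SC -/

theorem IsProfiniteSC.of_isClosedEmbedding {G' : Type*} [Group G'] [TopologicalSpace G']
    (h : IsProfiniteSC G) (f : G' →* G) (hf : Topology.IsClosedEmbedding f) :
    IsProfiniteSC G' := by
  rw [isProfiniteSC_iff] at h ⊢
  intro H hH
  obtain ⟨K, hK, hJ⟩ := h (H.map f) (by simpa using hf.isClosedMap _ hH)
  refine ⟨K.comap f, ?_, fun J hJc hHJ => ?_⟩
  · rw [eq_bot_iff]
    rintro x ⟨hx, hxK⟩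
    have : f x ∈ H.map f ⊓ K := ⟨Subgroup.mem_map_of_mem f hx, hxK⟩
    rw [hK, Subgroup.mem_bot, ← map_one f] at this
    exact hf.injective this
  · apply Subgroup.map_injective hf.injective
    have := hJ (J.map f) (by simpa using hf.isClosedMap _ hJc) (Subgroup.map_mono hHJ)
    rw [Subgroup.map_sup]
    convert this using 2
    ext y
    constructor
    · rintro ⟨x, ⟨hx, hxK⟩, rfl⟩
      exact ⟨⟨x, hx, rfl⟩, hxK⟩
    · rintro ⟨⟨x, hx, rfl⟩, hxK⟩
      exact ⟨x, ⟨hx, hxK⟩, rfl⟩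

theorem IsProfiniteSC.subgroup (h : IsProfiniteSC G) {M : Subgroup G}
    (hM : IsClosed (M : Set G)) : IsProfiniteSC M :=
  h.of_isClosedEmbedding M.subtype hM.isClosedEmbedding_subtypeVal

theorem IsProfiniteSC.of_surjective {G' : Type*} [Group G'] [TopologicalSpace G']
    (h : IsProfiniteSC G) (f : G →* G') (hf : Continuous f) (hs : Function.Surjective f) :
    IsProfiniteSC G' := by
  rw [isProfiniteSC_iff] at h ⊢
  intro H hH
  obtain ⟨K, hK, hJ⟩ := h (H.comap f) (hH.preimage hf)
  refine ⟨K.map f, ?_, fun J hJc hHJ => ?_⟩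
  · rw [eq_bot_iff]
    rintro _ ⟨hx, k, hk, rfl⟩
    have : k ∈ H.comap f ⊓ K := ⟨hx, hk⟩
    rw [hK, Subgroup.mem_bot] at this
    simp [this]
  · have := hJ (J.comap f) (hJc.preimage hf) (Subgroup.comap_mono hHJ)
    refine le_antisymm (sup_le hHJ inf_le_left) ?_
    calc J = (J.comap f).map f := (Subgroup.map_comap_eq_self_of_surjective hs J).symm
      _ = (H.comap f).map f ⊔ (J.comap f ⊓ K).map f := by rw [← Subgroup.map_sup, this]
      _ ≤ H ⊔ (J ⊓ K.map f) := sup_le_sup (Subgroup.map_comap_le f H) ?_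
    rintro _ ⟨x, ⟨hx, hxK⟩, rfl⟩
    exact ⟨hx, ⟨x, hxK, rfl⟩⟩

/-! ### Finite SC groups are solvable -/

/-- In a finite nilpotent group, a subgroup that generates the group together with the derived
subgroup is the whole group. -/
theorem Subgroup.eq_top_of_commutator_sup_eq_top {G : Type*} [Group G] [Finite G]
    [Group.IsNilpotent G] {K : Subgroup G} (h : _root_.commutator G ⊔ K = ⊤) : K = ⊤ := by
  rcases eq_top_or_exists_le_coatom K with hK | ⟨M, hM, hKM⟩
  · exact hK
  have hn : M.Normal :=
    NormalizerCondition.normal_of_coatom M Group.normalizerCondition_of_isNilpotent hM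
  obtain ⟨g, hg⟩ : ∃ g, g ∉ M := by
    by_contra! hc
    exact hM.1 (eq_top_iff.2 fun x _ => hc x)
  have hsup : M ⊔ Subgroup.zpowers g = ⊤ := by
    apply hM.2
    refine lt_of_le_of_ne le_sup_left fun he => hg ?_
    rw [he]
    exact Subgroup.mem_sup_right (Subgroup.mem_zpowers g)
  have hC : _root_.commutator G ≤ M :=
    Subgroup.Normal.commutator_le_of_self_sup_commutative_eq_top hsup inferInstance
  exact absurd (top_le_iff.1 (h ▸ sup_le hC hKM)) hM.1

/-- The derived subgroup consists of non-generators, so its complement is all of `G`, which meets it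
trivially. -/
theorem IsProfiniteSC.isMulCommutative_of_isNilpotent [DiscreteTopology G] [Finite G]
    [Group.IsNilpotent G] (h : IsProfiniteSC G) : IsMulCommutative G := by
  obtain ⟨K, hK, hJ⟩ := isProfiniteSC_iff.1 h (_root_.commutator G) (isClosed_discrete _)
  have hK1 : K = ⊤ := by
    apply Subgroup.eq_top_of_commutator_sup_eq_top
    have := hJ ⊤ isClosed_univ le_top
    rwa [top_inf_eq] at this
  rw [hK1, inf_top_eq, _root_.commutator_def, Subgroup.commutator_eq_bot_iff_le_centralizer] at hK
  refine ⟨⟨fun a b => ?_⟩⟩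
  exact (Subgroup.mem_centralizer_iff.1 (hK (Subgroup.mem_top b)) a (Subgroup.mem_top a))

/-- A normal subgroup of prime order `p` is central if the order of the group is prime to `p - 1`. -/
theorem Subgroup.le_center_of_card_prime {G : Type*} [Group G] [Finite G] {p : ℕ} [Fact p.Prime]
    (hG : (Nat.card G).Coprime (p - 1)) (N : Subgroup G) [N.Normal] (hN : Nat.card N = p) :
    N ≤ Subgroup.center G := by
  have hc : IsCyclic N := isCyclic_of_prime_card hN
  -- The image of `G` in `Aut N` has order dividing both `|G|` and `φ(p) = p - 1`.
  have hr : Nat.card (MulAut.conjNormal (H := N)).range = 1 := by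
    refine Nat.eq_one_of_dvd_coprimes hG (Subgroup.card_range_dvd _) ?_
    have := Subgroup.card_subgroup_dvd_card (MulAut.conjNormal (H := N)).range
    rwa [hc.card_mulAut, hN, Nat.totient_prime Fact.out] at this
  intro x hx
  rw [Subgroup.mem_center_iff]
  intro g
  have h1 : MulAut.conjNormal (H := N) g = 1 := by
    have : MulAut.conjNormal (H := N) g ∈ (MulAut.conjNormal (H := N)).range := ⟨g, rfl⟩
    rwa [Subgroup.card_eq_one.1 hr, Subgroup.mem_bot] at this
  have h2 : g * x * g⁻¹ = x := by
    rw [← MulAut.conjNormal_apply (H := N) g ⟨x, hx⟩, h1]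
    rfl
  exact mul_inv_eq_iff_eq_mul.1 h2

/-- If `c = [g, x] ≠ 1` with `x ∈ Q`, let `H ≤ ⟨c⟩` have order `p`, with `K` as in SC. Then `Q ∩ K`
is normal in `G = ⟨H, K⟩`: `H` centralizes it since `Q` is abelian, and `K` normalizes it since `Q`
is normal. Modulo `Q ∩ K`, `Q` has order `p` and so is central; hence `c ∈ K`, contradicting `H ∩ K
= 1`. -/
theorem IsProfiniteSC.le_center [DiscreteTopology G] [Finite G] (h : IsProfiniteSC G) {p : ℕ}
    [Fact p.Prime] (hG : (Nat.card G).Coprime (p - 1)) (Q : Subgroup G) [Q.Normal]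
    [IsMulCommutative Q] (hQ : IsPGroup p Q) : Q ≤ Subgroup.center G := by
  intro x hx
  rw [Subgroup.mem_center_iff]
  intro g
  by_contra hne
  set c := g * x * g⁻¹ * x⁻¹ with hc
  have hcQ : c ∈ Q := mul_mem (Subgroup.Normal.conj_mem inferInstance x hx g) (inv_mem hx)
  have hc1 : c ≠ 1 := fun h1 => hne (by
    rw [hc, mul_inv_eq_one, mul_inv_eq_iff_eq_mul] at h1; exact h1)
  obtain ⟨n, hn⟩ : ∃ n, orderOf c = p ^ (n + 1) := by
    obtain ⟨k, hk⟩ := IsPGroup.iff_orderOf.1 hQ ⟨c, hcQ⟩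
    rw [Subgroup.orderOf_mk] at hk
    cases k with
    | zero => exact absurd (orderOf_eq_one_iff.1 (by simpa using hk)) hc1
    | succ n => exact ⟨n, hk⟩
  have ho : orderOf (c ^ p ^ n) = p := by
    rw [orderOf_pow' _ (pow_ne_zero _ (Fact.out : p.Prime).ne_zero), hn,
      Nat.gcd_eq_right (pow_dvd_pow p n.le_succ), pow_succ,
      Nat.mul_div_cancel_left _ (pow_pos (Fact.out : p.Prime).pos _)]
  set H := Subgroup.zpowers (c ^ p ^ n) with hH
  have hHQ : H ≤ Q := (Subgroup.zpowers_le).2 (pow_mem hcQ _)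
  obtain ⟨K, hK, hJ⟩ := isProfiniteSC_iff.1 h H (isClosed_discrete _)
  have hA : H ⊔ (Q ⊓ K) = Q := hJ Q (isClosed_discrete _) hHQ
  have hT : H ⊔ K = ⊤ := by simpa using hJ ⊤ isClosed_univ le_top
  have hAn : (Q ⊓ K).Normal := by
    rw [← Subgroup.normalizer_eq_top_iff, ← top_le_iff, ← hT]
    refine sup_le (hHQ.trans ?_) (fun k hk => ?_)
    · refine le_trans ?_ (Subgroup.centralizer_le_normalizer _)
      refine le_trans ?_ (Subgroup.centralizer_le inf_le_left)
      exact Subgroup.le_centralizer Q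
    · rw [Subgroup.mem_normalizer_iff]
      intro y
      refine and_congr ?_ ?_
      · exact (by rw [Subgroup.Normal.mem_comm_iff (H := Q) inferInstance, inv_mul_cancel_left] :
          k * y * k⁻¹ ∈ Q ↔ y ∈ Q).symm
      · exact ((Subgroup.mul_mem_cancel_right K (inv_mem hk)).trans
          (Subgroup.mul_mem_cancel_left K hk)).symm
  have hmap : Q.map (QuotientGroup.mk' (Q ⊓ K)) = H.map (QuotientGroup.mk' (Q ⊓ K)) := by
    have hmA := congrArg (Subgroup.map (QuotientGroup.mk' (Q ⊓ K))) hA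
    rwa [Subgroup.map_sup, QuotientGroup.map_mk'_self, sup_bot_eq, eq_comm] at hmA
  have hcard : Nat.card (Q.map (QuotientGroup.mk' (Q ⊓ K))) = p := by
    rw [hmap, ← ho, ← Nat.card_zpowers, ← hH]
    refine Nat.card_image_of_injOn (s := (H : Set G)) fun a ha b hb hab => ?_
    have hmem : a⁻¹ * b ∈ H ⊓ K :=
      ⟨mul_mem (S := Subgroup G) (inv_mem (S := Subgroup G) ha) hb, (QuotientGroup.eq.1 hab).2⟩
    rw [hK, Subgroup.mem_bot] at hmem
    exact inv_mul_eq_one.1 hmem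
  have hcop : (Nat.card (G ⧸ (Q ⊓ K))).Coprime (p - 1) :=
    hG.coprime_dvd_left (Subgroup.card_quotient_dvd_card _)
  have hcen := Subgroup.le_center_of_card_prime hcop (Q.map (QuotientGroup.mk' (Q ⊓ K))) hcard
  have hcA : c ∈ Q ⊓ K := by
    rw [← QuotientGroup.eq_one_iff]
    have := Subgroup.mem_center_iff.1 (hcen (Subgroup.mem_map_of_mem _ hx))
      (QuotientGroup.mk' _ g)
    rw [hc]
    simp only [QuotientGroup.mk'_apply] at this
    simp only [QuotientGroup.mk_mul, QuotientGroup.mk_inv, this]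
    group
  have : c ^ p ^ n ∈ H ⊓ K := ⟨Subgroup.mem_zpowers _, pow_mem hcA.2 _⟩
  rw [hK, Subgroup.mem_bot, ← orderOf_eq_one_iff, ho] at this
  exact (Fact.out : p.Prime).one_lt.ne' this

/-- The hypothesis of Burnside's transfer theorem; it comes from `le_center` applied inside the
normalizer. -/
theorem IsProfiniteSC.normalizer_le_centralizer [DiscreteTopology G] [Finite G]
    (h : IsProfiniteSC G) {p : ℕ} [Fact p.Prime] (hG : (Nat.card G).Coprime (p - 1))
    (P : Sylow p G) :
    Subgroup.normalizer (P : Set G) ≤ Subgroup.centralizer (P : Set G) := by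
  have hP : IsProfiniteSC (P : Subgroup G) := h.subgroup (isClosed_discrete _)
  have : Group.IsNilpotent (P : Subgroup G) := P.2.isNilpotent
  have hcomm : IsMulCommutative (P : Subgroup G) := hP.isMulCommutative_of_isNilpotent
  set M := Subgroup.normalizer (P : Set G) with hM
  have hPM : (P : Subgroup G) ≤ M := Subgroup.le_normalizer
  have hMsc : IsProfiniteSC M := h.subgroup (isClosed_discrete _)
  have hn : ((P : Subgroup G).subgroupOf M).Normal := Subgroup.normal_in_normalizer
  have hc2 : IsMulCommutative ((P : Subgroup G).subgroupOf M) := inferInstance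
  have hz := hMsc.le_center
    (hG.coprime_dvd_left (Subgroup.card_subgroup_dvd_card M)) ((P : Subgroup G).subgroupOf M)
    (P.2.of_equiv (Subgroup.subgroupOfEquivOfLe hPM).symm)
  intro g hg
  rw [Subgroup.mem_centralizer_iff]
  intro x hx
  have hxc : (⟨x, hPM hx⟩ : M) ∈ Subgroup.center M := hz (by simpa [Subgroup.mem_subgroupOf])
  exact (congrArg Subtype.val (Subgroup.mem_center_iff.1 hxc ⟨g, hg⟩)).symm

theorem Nat.coprime_minFac_sub_one {n : ℕ} (h1 : n ≠ 1) :
    n.Coprime (n.minFac - 1) := by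
  by_contra hc
  obtain ⟨q, hq, hqn, hqp⟩ := Nat.Prime.not_coprime_iff_dvd.1 hc
  have hp := Nat.minFac_prime h1
  have h2 := Nat.minFac_le_of_dvd hq.two_le hqn
  have h3 := Nat.le_of_dvd (Nat.sub_pos_of_lt hp.one_lt) hqp
  have := hp.one_lt
  omega

theorem IsProfiniteSC.isSolvable [DiscreteTopology G] [Finite G] (h : IsProfiniteSC G) :
    Group.IsSolvable G := by
  -- Inducting over subgroups of the fixed `G` keeps the transfer kernel within the scope of the
  -- hypothesis.
  suffices H : ∀ n, ∀ M : Subgroup G, Nat.card M = n → Group.IsSolvable M by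
    have := H _ ⊤ rfl
    exact Group.isSolvable_of_surjective (f := (Subgroup.topEquiv (G := G)).toMonoidHom)
      Subgroup.topEquiv.surjective
  intro n
  induction n using Nat.strong_induction_on with
  | _ n ih =>
    intro M hM
    have hMsc : IsProfiniteSC M := h.subgroup (isClosed_discrete _)
    by_cases h1 : Nat.card M = 1
    · have := (Nat.card_eq_one_iff_unique.1 h1).1
      infer_instance
    set p := (Nat.card M).minFac with hp
    have : Fact p.Prime := ⟨Nat.minFac_prime h1⟩
    let P : Sylow p M := default
    have hNC := hMsc.normalizer_le_centralizer
      (Nat.coprime_minFac_sub_one h1) P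
    have : Group.IsNilpotent (P : Subgroup M) := P.2.isNilpotent
    set f := MonoidHom.transferSylow P hNC with hf
    have hker : Group.IsSolvable f.ker := by
      have hlt : Nat.card f.ker < n := by
        rw [← hM]
        refine lt_of_le_of_ne (Subgroup.card_le_card_group _) fun he => ?_
        have hnd := MonoidHom.not_dvd_card_ker_transferSylow P hNC
        rw [← hf, he] at hnd
        exact hnd (Nat.minFac_dvd _)
      have hs := ih _ hlt (f.ker.map M.subtype)
        (Nat.card_congr (f.ker.equivMapOfInjective _ M.subtype_injective).symm.toEquiv)
      exact Group.isSolvable_of_isSolvable_injective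
        (f := (f.ker.equivMapOfInjective _ M.subtype_injective).toMonoidHom)
        (f.ker.equivMapOfInjective _ M.subtype_injective).injective
    exact Group.isSolvable_of_ker_le_range f.ker.subtype f (by simp)

/-! ### Proper supplements in solvable SC groups -/

/-- In a discrete solvable `SC`-group, every nontrivial subgroup has a proper supplement. -/
theorem IsProfiniteSC.exists_supplement_of_isSolvable [DiscreteTopology G] [Group.IsSolvable G]
    (h : IsProfiniteSC G) {D : Subgroup G} (hD : D ≠ ⊥) :
    ∃ L : Subgroup G, L ≠ ⊤ ∧ (D : Set G) * (L : Set G) = Set.univ := by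
  classical
  have hex : ∃ k, ¬ D ≤ derivedSeries G k := by
    obtain ⟨n, hn⟩ := Group.IsSolvable.solvable (G := G)
    exact ⟨n, fun hle => hD (le_bot_iff.1 (hn ▸ hle))⟩
  obtain ⟨k, hDk, hDk1⟩ : ∃ k, D ≤ derivedSeries G k ∧ ¬ D ≤ derivedSeries G (k + 1) := by
    have hpos : Nat.find hex ≠ 0 := fun h0 => by
      have := Nat.find_spec hex
      rw [h0] at this
      exact this (by simp)
    obtain ⟨k, hk⟩ := Nat.exists_eq_succ_of_ne_zero hpos
    refine ⟨k, not_not.1 (Nat.find_min hex (by omega)), ?_⟩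
    rw [← Nat.succ_eq_add_one, ← hk]
    exact Nat.find_spec hex
  obtain ⟨x, hxD, hxN⟩ := SetLike.not_le_iff_exists.1 hDk1
  set Q := derivedSeries G k with hQ
  set N := derivedSeries G (k + 1) with hN
  have hQn : Q.Normal := derivedSeries_normal G k
  have hNn : N.Normal := derivedSeries_normal G (k + 1)
  have hNQ : N = ⁅Q, Q⁆ := derivedSeries_succ G k
  have hNQ' : N ≤ Q := hNQ ▸ Subgroup.commutator_le_left Q Q
  -- As `N = [Q, Q] ≤ H ≤ Q`, `H` is normal in `Q`; this later turns `Q = ⟨H, Q ∩ K⟩` into a product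
  -- of sets.
  set H := Subgroup.zpowers x ⊔ N with hH
  have hHQ : H ≤ Q := sup_le (Subgroup.zpowers_le.2 (hDk hxD)) hNQ'
  obtain ⟨K, hK, hJ⟩ := isProfiniteSC_iff.1 h H (isClosed_discrete _)
  have hA : H ⊔ (Q ⊓ K) = Q := hJ Q (isClosed_discrete _) hHQ
  have hT : H ⊔ K = ⊤ := by simpa using hJ ⊤ isClosed_univ le_top
  -- `NK` is proper: `x = ny` would force `y ∈ H ∩ K = 1`, hence `x ∈ N`. It supplements `D` since
  -- `G = QK = H(Q ∩ K)K = ⟨x⟩NK`.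
  refine ⟨N ⊔ K, fun htop => ?_, ?_⟩
  · obtain ⟨n, hn, y, hy, hxy⟩ := Subgroup.mem_sup_of_normal_left.1
      (htop ▸ Subgroup.mem_top x : x ∈ N ⊔ K)
    have hyH : y ∈ H ⊓ K := by
      refine ⟨(Subgroup.mul_mem_cancel_left H (Subgroup.mem_sup_right hn)).1 ?_, hy⟩
      rw [hxy]
      exact Subgroup.mem_sup_left (Subgroup.mem_zpowers x)
    rw [hK, Subgroup.mem_bot] at hyH
    rw [hyH, mul_one] at hxy
    exact hxN (hxy ▸ hn)
  · refine Set.eq_univ_of_forall fun g => ?_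
    have hQK : Q ⊔ K = ⊤ := top_le_iff.1 (hT ▸ sup_le_sup_right hHQ K)
    obtain ⟨q, hq, y, hy, rfl⟩ := Subgroup.mem_sup_of_normal_left.1
      (hQK ▸ Subgroup.mem_top g : g ∈ Q ⊔ K)
    have hq' : q ∈ H ⊔ (Q ⊓ K) := hA.symm ▸ hq
    have hnorm : (Q ⊓ K) ≤ Subgroup.normalizer (H : Set G) := by
      refine inf_le_left.trans fun a ha => ?_
      rw [Subgroup.mem_normalizer_iff]
      have key : ∀ b ∈ Q, ∀ z ∈ H, b * z * b⁻¹ ∈ H := fun b hb z hz => by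
        have : b * z * b⁻¹ * z⁻¹ ∈ N := hNQ ▸ Subgroup.commutator_mem_commutator hb (hHQ hz)
        simpa using mul_mem (Subgroup.mem_sup_right this : _ ∈ H) hz
      exact fun z => ⟨key a ha z, fun hz => by
        simpa [mul_assoc] using key a⁻¹ (inv_mem ha) _ hz⟩
    have hset : q ∈ (H : Set G) * ((Q ⊓ K : Subgroup G) : Set G) := by
      rw [← Subgroup.coe_mul_of_right_le_normalizer_left _ _ hnorm]
      exact hq'
    obtain ⟨a, ha, b, hb, rfl⟩ := hset
    obtain ⟨d, hd, n, hn, rfl⟩ := Subgroup.mem_sup_of_normal_right.1 ha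
    refine ⟨d, Subgroup.zpowers_le.2 hxD hd, n * (b * y), ?_, by simp [mul_assoc]⟩
    exact mul_mem (Subgroup.mem_sup_left hn) (Subgroup.mem_sup_right (mul_mem hb.2 hy))

end SC

/-! ### Minimal closed supplements by compactness -/

theorem Subgroup.mul_sInf_eq_univ_of_isChain {G : Type*} [Group G] [TopologicalSpace G]
    [IsTopologicalGroup G] [CompactSpace G] {H : Subgroup G} (hH : IsClosed (H : Set G))
    {c : Set (Subgroup G)} (hc : IsChain (· ≤ ·) c) (hne : c.Nonempty)
    (hcl : ∀ K ∈ c, IsClosed (K : Set G) ∧ (H : Set G) * (K : Set G) = Set.univ) :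
    (H : Set G) * ((sInf c : Subgroup G) : Set G) = Set.univ := by
  refine Set.eq_univ_of_forall fun g => ?_
  have : Nonempty c := hne.to_subtype
  have hclosed : ∀ K : c, IsClosed {k : G | k ∈ (K : Subgroup G) ∧ g * k⁻¹ ∈ H} := fun K =>
    (hcl K K.2).1.inter (hH.preimage (by fun_prop : Continuous fun k : G => g * k⁻¹))
  -- For fixed `g`, the possible right factors in `K` form nested nonempty compact sets; a common
  -- point factors `g` over the intersection.
  obtain ⟨k, hk⟩ := IsCompact.nonempty_iInter_of_directed_nonempty_isCompact_isClosed
    (fun K : c => {k : G | k ∈ (K : Subgroup G) ∧ g * k⁻¹ ∈ H})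
    (fun K L => by
      rcases hc.total K.2 L.2 with hKL | hLK
      · exact ⟨K, subset_rfl, fun k hk => ⟨hKL hk.1, hk.2⟩⟩
      · exact ⟨L, fun k hk => ⟨hLK hk.1, hk.2⟩, subset_rfl⟩)
    (fun K => by
      obtain ⟨a, ha, k, hk, rfl⟩ := (hcl K K.2).2.symm ▸ Set.mem_univ g
      exact ⟨k, hk, by simpa using ha⟩)
    (fun K => (hclosed K).isCompact) hclosed
  rw [Set.mem_iInter] at hk
  refine ⟨g * k⁻¹, (hk (Classical.arbitrary c)).2, k, ?_, by simp⟩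
  exact Subgroup.mem_sInf.2 fun K hK => (hk ⟨K, hK⟩).1

theorem Subgroup.exists_minimal_isClosed_supplement {G : Type*} [Group G] [TopologicalSpace G]
    [IsTopologicalGroup G] [CompactSpace G] {H : Subgroup G} (hH : IsClosed (H : Set G)) :
    ∃ K : Subgroup G, Minimal
      (fun K : Subgroup G => IsClosed (K : Set G) ∧ (H : Set G) * (K : Set G) = Set.univ) K := by
  obtain ⟨K, -, hK⟩ := @zorn_le_nonempty₀ (Subgroup G)ᵒᵈ _
    {K : Subgroup G | IsClosed (K : Set G) ∧ (H : Set G) * (K : Set G) = Set.univ}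
    (fun c hcs hc y hy => ⟨(sInf c : Subgroup G),
      ⟨(Subgroup.coe_sInf (G := G) c).symm ▸ isClosed_biInter fun K hK => (hcs hK).1,
        Subgroup.mul_sInf_eq_univ_of_isChain hH hc.symm ⟨y, hy⟩ hcs⟩,
      fun z hz => sInf_le (α := Subgroup G) hz⟩)
    (⊤ : Subgroup G) ⟨isClosed_univ, Set.eq_univ_of_forall fun g =>
      ⟨1, one_mem H, g, Subgroup.mem_top g, one_mul g⟩⟩
  exact ⟨K, hK⟩

/-! ### From finite quotients to profinite groups -/

section Profinite

variable {G : Type*} [Group G] [TopologicalSpace G] [IsTopologicalGroup G] [CompactSpace G]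
  [TotallyDisconnectedSpace G]

/-- Some open normal `N` misses a given `d ≠ 1` of `D`, so `D` survives in the finite SC group
`G/N`, and a supplement there pulls back. -/
theorem IsProfiniteSC.exists_isClosed_supplement (h : IsProfiniteSC G) {D : Subgroup G}
    (hD : D ≠ ⊥) : ∃ L : Subgroup G, IsClosed (L : Set G) ∧ L ≠ ⊤ ∧
      (D : Set G) * (L : Set G) = Set.univ := by
  obtain ⟨d, hdD, hd1⟩ := (Subgroup.bot_or_exists_ne_one D).resolve_left hD
  obtain ⟨N, hN⟩ := ProfiniteGrp.exist_openNormalSubgroup_sub_open_nhds_of_one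
    (isOpen_compl_singleton (x := d)) (by simpa using hd1.symm)
  have hdN : d ∉ N.toSubgroup := fun hmem => hN hmem rfl
  have : DiscreteTopology (G ⧸ N.toSubgroup) := QuotientGroup.discreteTopology N.isOpen
  have : Finite (G ⧸ N.toSubgroup) := finite_of_compact_of_discrete
  have hq : IsProfiniteSC (G ⧸ N.toSubgroup) := h.of_surjective (QuotientGroup.mk' N.toSubgroup)
    QuotientGroup.continuous_mk (QuotientGroup.mk'_surjective _)
  have := hq.isSolvable
  obtain ⟨L, hL, hDL⟩ := hq.exists_supplement_of_isSolvable
    (D := D.map (QuotientGroup.mk' N.toSubgroup)) (fun hbot => hdN (by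
      rw [← QuotientGroup.eq_one_iff, ← Subgroup.mem_bot, ← hbot]
      exact Subgroup.mem_map_of_mem (QuotientGroup.mk' N.toSubgroup) hdD))
  refine ⟨L.comap (QuotientGroup.mk' N.toSubgroup),
    (isClosed_discrete (L : Set (G ⧸ N.toSubgroup))).preimage QuotientGroup.continuous_mk,
    fun htop => hL ?_, Set.eq_univ_of_forall fun g => ?_⟩
  · rw [← Subgroup.map_comap_eq_self_of_surjective (QuotientGroup.mk'_surjective _) L, htop,
      ← MonoidHom.range_eq_map, MonoidHom.range_eq_top]
    exact QuotientGroup.mk'_surjective _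
  · obtain ⟨_, ⟨a, ha, rfl⟩, l, hl, hg⟩ := hDL.symm ▸ Set.mem_univ (QuotientGroup.mk' N.toSubgroup g)
    refine ⟨a, ha, a⁻¹ * g, ?_, by simp⟩
    have : QuotientGroup.mk' N.toSubgroup (a⁻¹ * g) = l := by
      rw [map_mul, map_inv, ← hg]
      simp
    exact (this ▸ hl : QuotientGroup.mk' N.toSubgroup (a⁻¹ * g) ∈ L)

theorem IsProfiniteSC.isProfiniteC (h : IsProfiniteSC G) : IsProfiniteC G := by
  intro H hH
  obtain ⟨K, ⟨hKc, hHK⟩, hmin⟩ := Subgroup.exists_minimal_isClosed_supplement hH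
  refine ⟨K, hKc, Subgroup.isComplement'_of_disjoint_and_mul_eq_univ ?_ hHK⟩
  rw [← Subgroup.subgroupOf_eq_bot]
  by_contra hne
  have : CompactSpace K := isCompact_iff_compactSpace.1 hKc.isCompact
  obtain ⟨L, hLc, hL, hDL⟩ := (h.subgroup hKc).exists_isClosed_supplement hne
  -- `G = HK = H(H ∩ K)L = HL`, so minimality puts `K` inside `L`.
  have hle := hmin (y := L.map K.subtype)
    ⟨hKc.isClosedEmbedding_subtypeVal.isClosedMap _ hLc,
      Set.eq_univ_of_forall fun g => ?_⟩ (Subgroup.map_subtype_le L)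
  · refine hL (eq_top_iff.2 fun x _ => ?_)
    obtain ⟨y, hy, hyx⟩ := hle x.2
    rwa [← Subtype.ext hyx]
  · obtain ⟨a, ha, k, hk, rfl⟩ := hHK.symm ▸ Set.mem_univ g
    obtain ⟨d, hd, l, hl, hdl⟩ := hDL.symm ▸ Set.mem_univ (⟨k, hk⟩ : K)
    refine ⟨a * d, mul_mem ha hd, l, ⟨l, hl, rfl⟩, ?_⟩
    have : (d : G) * l = k := congrArg Subtype.val hdl
    simp [mul_assoc, this]

end Profinite

theorem mainTheorem7 (G : Type*) [Group G] [TopologicalSpace G] [IsTopologicalGroup G]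
    [CompactSpace G] [T2Space G] [TotallyDisconnectedSpace G] :
    IsProfiniteSC G ↔ IsProfiniteC G :=
  ⟨IsProfiniteSC.isProfiniteC, IsProfiniteC.isProfiniteSC⟩
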